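/- **Model.** One round of continuous Guts for $n$ players with stakes $1$: the hands $p_1,\dots,p_n$ are independent and uniform on $[0,1]$; player $i$ chooses a threshold $p_i^*\in[0,1]$ and holds if $p_i\ge p_i^*$, drops otherwise. If nobody holds, every immediate return is $0$ and the round is replayed with the same stakes. If $r\ge1$ players hold, the stakes are multiplied by $r-1$ (the game ends if $r=1$), every player receives $r-2$, in addition the holder with the best hand receives $n$ and every other holder pays $n$. Let $\alpha$ be the expected immediate return of player 1 and $\beta$ the expected stakes factor. A mixed strategy of a player, or of a coalition, is a probability measure on the thresholds, or on the lists of thresholds of its members, drawn independently of the opponents; in the repeated game a player or coalition chooses one for every round. For a sequence of rounds with expected immediate returns $\alpha_{i,k}$ of player $i$ and stakes factors $\beta_k$, the expected return of player $i$ in the game truncated after $N$ rounds with termination fee $t\ge0$ is $\sum_{k<N}\big(\prod_{j<k}\beta_j\big)\alpha_{i,k}-t\prod_{j<N}\beta_j$, and the joint return of a coalition is the sum over its members. A coalition can profit by deviating from a profile if, for some sequence of its joint mixed strategies, the others keeping to the profile, its joint truncated returns exceed those at the profile by a fixed positive amount for all large $N$. A profile is a Nash equilibrium if no single player, and a strong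 Nash equilibrium if no coalition, can profit by deviating. **Corollary 7.16.** Let $n\ge4$ and $p_*=(1/2)^{1/(n-1)}$. For $\epsilon,\delta>0$ consider the pure strategies of players $2,\dots,n$ $$A:\ (p_2^*,\dots,p_n^*)=(p_*-\epsilon,\dots,p_*-\epsilon),\qquad B:\ (p_2^*,\dots,p_n^*)=(0,p_*+\delta,\dots,p_*+\delta).$$ There are $\delta>0$ with $p_*+\delta\le1$, $\beta_0<1$ and $C_1>0$, depending only on $n$, such that for every $C\ge C_1$ there is $\epsilon_1>0$ such that for all $0<\epsilon<\epsilon_1$: $p_*-\epsilon\ge0$, $C\epsilon^2\le1$, and the mixed strategy $(1-C\epsilon^2)A+C\epsilon^2B$ satisfies 1. $\alpha<0$ and $\beta\le\beta_0<1$ against every $p_1^*\in[0,1]$; 2. it is a winning strategy for players $2$–$n$: there is $v>0$ such that for every $t\ge0$ there is $N_0$ such that, when it is played in every round, the joint return of players $2$–$n$ in the game truncated after $N$ rounds with termination fee $t$ for each player is at least $v$, for every $N\ge N_0$ and every sequence of mixed strategies of player 1. Moreover, for every $t\ge0$, the symmetric profile $(p_*,\dots,p_*)$ is a Nash equilibrium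 but not a strong Nash equilibrium. -/

import Mathlib

open MeasureTheory Filter

noncomputable section

namespace Guts

/-! One round of continuous Guts with `n` players. A pure strategy of a player is a threshold in
`[0, 1]`; `p : Fin n → ℝ` lists the thresholds and `x : Fin n → ℝ` the hands. -/

/-- The players who hold: player `i` holds if the hand `x i` is at least the threshold `p i`,
and drops otherwise. -/
def holders {n : ℕ} (p x : Fin n → ℝ) : Finset (Fin n) :=
  Finset.univ.filter fun i => p i ≤ x i

/-- The immediate return of player `i` in one round with stakes `1` (antes are accounted for at
termination). If everybody drops it is `0`. If `r ≥ 1` players hold, then everybody receives the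
virtual ante `r - 2`, the holder with the best hand wins in addition the pot `n`, and every other
holder loses in addition `n`. (Ties have probability zero.) -/
def roundReturn {n : ℕ} (p x : Fin n → ℝ) (i : Fin n) : ℝ :=
  if holders p x = ∅ then 0
  else ((holders p x).card - 2 : ℝ) +
    if i ∈ holders p x then
      if ∀ j ∈ holders p x, x j ≤ x i then (n : ℝ) else -(n : ℝ)
    else 0

/-- The factor by which the stakes are multiplied for the next round: `1` if everybody drops, and
`r - 1` if `r ≥ 1` players hold (so `0`, the end of the game, if `r = 1`). -/
def roundStakes {n : ℕ} (p x : Fin n → ℝ) : ℝ :=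
  if holders p x = ∅ then 1 else ((holders p x).card - 1 : ℝ)

/-- The law of the hands: independent and uniform on `[0, 1]`. -/
def handLaw (n : ℕ) : Measure (Fin n → ℝ) :=
  Measure.pi fun _ => (volume : Measure ℝ).restrict (Set.Icc 0 1)

/-- The expected immediate return of player `i` for the threshold profile `p`. -/
def alpha {n : ℕ} (p : Fin n → ℝ) (i : Fin n) : ℝ :=
  ∫ x, roundReturn p x i ∂(handLaw n)

/-- The expected stakes factor for the threshold profile `p`. -/
def beta {n : ℕ} (p : Fin n → ℝ) : ℝ :=
  ∫ x, roundStakes p x ∂(handLaw n)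

/-! Mixed play. -/

/-- A law of threshold lists: a probability measure concentrated on `[0, 1]^k`. -/
def IsMixed {k : ℕ} (P : Measure (Fin k → ℝ)) : Prop :=
  IsProbabilityMeasure P ∧ ∀ᵐ p ∂P, ∀ i, p i ∈ Set.Icc (0 : ℝ) 1

/-- A mixed strategy of a single player: a probability measure concentrated on `[0, 1]`. -/
def IsMixedSingle (μ : Measure ℝ) : Prop :=
  IsProbabilityMeasure μ ∧ ∀ᵐ s ∂μ, s ∈ Set.Icc (0 : ℝ) 1

/-- The expected immediate return of player `i` if the profile is drawn from `P`. -/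
def mixedAlpha {n : ℕ} (P : Measure (Fin n → ℝ)) (i : Fin n) : ℝ :=
  ∫ p, alpha p i ∂P

/-- The expected stakes factor if the profile is drawn from `P`. -/
def mixedBeta {n : ℕ} (P : Measure (Fin n → ℝ)) : ℝ :=
  ∫ p, beta p ∂P

/-- The law of the profile if player 1 (index `0`) draws a threshold from `μ` and the coalition of
the other `m` players draws, independently of player 1, a list of thresholds from `ν`. -/
def versus {m : ℕ} (μ : Measure ℝ) (ν : Measure (Fin m → ℝ)) : Measure (Fin (m + 1) → ℝ) :=
  (μ.prod ν).map fun z => (Fin.cons z.1 z.2 : Fin (m + 1) → ℝ)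

/-- The mixed coalition strategy playing `a` with probability `1 - w` and `b` with probability
`w`. -/
def mix {m : ℕ} (w : ℝ) (a b : Fin m → ℝ) : Measure (Fin m → ℝ) :=
  ENNReal.ofReal (1 - w) • Measure.dirac a + ENNReal.ofReal w • Measure.dirac b

/-! The repeated game. Round `k` is played with a profile drawn from `P k`. -/

/-- The expected stakes at the beginning of round `N`. -/
def stakes {n : ℕ} (P : ℕ → Measure (Fin n → ℝ)) (N : ℕ) : ℝ :=
  ∏ k ∈ Finset.range N, mixedBeta (P k)

/-- The expected return of player `i` in the game truncated after `N` rounds, where the player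
pays `t` times the current stakes if the game has to be terminated there. -/
def truncatedReturn {n : ℕ} (t : ℝ) (P : ℕ → Measure (Fin n → ℝ)) (N : ℕ) (i : Fin n) : ℝ :=
  ∑ k ∈ Finset.range N, stakes P k * mixedAlpha (P k) i - t * stakes P N

/-- The expected joint return of the players in `S` in the truncated game. -/
def jointReturn {n : ℕ} (t : ℝ) (P : ℕ → Measure (Fin n → ℝ)) (N : ℕ) (S : Finset (Fin n)) : ℝ :=
  ∑ i ∈ S, truncatedReturn t P N i

/-- The coalition of all players but player 1. -/
def others (m : ℕ) : Finset (Fin (m + 1)) := Finset.univ.erase 0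

/-- `ν`, played in every round, is a winning strategy for the coalition of all players but
player 1: it forces a joint return of at least some fixed `v > 0`, whatever mixed strategies
player 1 uses in the successive rounds and whatever the termination fee, in every truncated game
that is long enough. -/
def IsWinning {m : ℕ} (ν : Measure (Fin m → ℝ)) : Prop :=
  ∃ v : ℝ, 0 < v ∧ ∀ t : ℝ, 0 ≤ t → ∃ N₀ : ℕ, ∀ N ≥ N₀, ∀ μ : ℕ → Measure ℝ, (∀ k, IsMixedSingle (μ k)) →
    v ≤ jointReturn t (fun k => versus (μ k) ν) N (others m)

/-- In every round the players outside `S` keep to the profile `s`, and those in `S` play some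
joint mixed strategy. -/
def IsDeviation {n : ℕ} (S : Finset (Fin n)) (s : Fin n → ℝ) (P : ℕ → Measure (Fin n → ℝ)) :
    Prop :=
  ∀ k, IsMixed (P k) ∧ ∀ᵐ p ∂(P k), ∀ i ∉ S, p i = s i

/-- The coalition `S` can jointly profit by a deviation from the profile `s`: its joint return in
the truncated games eventually exceeds the one at `s` by some fixed amount. -/
def CanProfit {n : ℕ} (t : ℝ) (S : Finset (Fin n)) (s : Fin n → ℝ) : Prop :=
  ∃ P : ℕ → Measure (Fin n → ℝ), IsDeviation S s P ∧
    ∃ c : ℝ, 0 < c ∧ ∀ᶠ N in atTop,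
      jointReturn t (fun _ => Measure.dirac s) N S + c ≤ jointReturn t P N S

/-- No single player can profit by a deviation from `s`. -/
def IsNash {n : ℕ} (t : ℝ) (s : Fin n → ℝ) : Prop :=
  ∀ i, ¬ CanProfit t {i} s

/-- No coalition can jointly profit by a deviation from `s`. -/
def IsStrongNash {n : ℕ} (t : ℝ) (s : Fin n → ℝ) : Prop :=
  ∀ S, ¬ CanProfit t S s

/-- The equilibrium threshold `(1/2)^(1/(n-1))` of the game with `n = m + 1` players. -/
def threshold (m : ℕ) : ℝ := (1 / 2 : ℝ) ^ (1 / (m : ℝ))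

/-- Bloc play of the coalition at the threshold `(1/2)^(1/(n-1)) - ε`. -/
def blocA (m : ℕ) (ε : ℝ) : Fin m → ℝ := fun _ => threshold m - ε

/-- The coalition strategy `(0, (1/2)^(1/(n-1)) + δ, …, (1/2)^(1/(n-1)) + δ)`: player 2 always
holds. -/
def nonblocB (m : ℕ) (δ : ℝ) : Fin m → ℝ := fun j => if (j : ℕ) = 0 then 0 else threshold m + δ

end Guts

end

/-! ### Expected return and stakes factor in closed form -/

namespace Guts

/-! Write `m = n - 1` and `q = threshold m`, so `2 * q ^ m = 1`. Two estimates of opposite nature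
are combined.

If the coalition plays `q - ε` as a bloc, the return of player 1 at `x = q - ε + u` with `u ≥ 0` is
at most `2m²εu - (m/2)u²`, hence at most `2m³ε²` (`alpha_le_of_perturbation`); below `q - ε` it is
not positive. At distance at least `η` from `q`, the return is at most `-(mη/4)ε`
(`alpha_le_of_far`). So the bloc strategy fails only near `q`, and only to second order in `ε`.

Against the non-bloc strategy, thresholds near `q` lose a fixed amount `c` (`exists_nonblocB`): with
`x = q` and the common threshold `Q` of the `m - 1` ordinary opponents, the return vanishes at `Q =
q` and has slope `-(m - 1)` in `Q` there, so some `Q = q + δ` makes it negative.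

Mixing in the non-bloc strategy with weight `Cε²` therefore gains `Cc ε²` near `q`, which beats
`2m³ε²` for large `C`, and costs only `O(ε²)` far from `q`, where the bloc strategy gains order `ε`
(`exists_mix_bounds`). The stakes factor stays near `m(1 - q)`, which is below `1` because `(1 -
1/m)^m ≤ 1/e < 1/2`.

A round is zero-sum, so the coalition earns a fixed amount in the first round and loses nothing
later, while the fee shrinks geometrically (`isWinning_of_bounds`). At the symmetric profile every
return is `0`. A single deviator has return at most `0` and does not even change the stakes factor,
whence the Nash property; the winning coalition strategy refutes the strong one. -/

theorem card_holders {n : ℕ} (p x : Fin n → ℝ) :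
    ((holders p x).card : ℝ) = ∑ j, if p j ≤ x j then (1 : ℝ) else 0 := by
  simp [holders]

theorem holders_eq_empty_iff {n : ℕ} (p x : Fin n → ℝ) :
    holders p x = ∅ ↔ ∀ j, ¬ p j ≤ x j := by
  simp [holders, Finset.filter_eq_empty_iff]

/-- The product detects that nobody holds, and there `0 - 1 + 2` is the prescribed factor. What
remains are sums and products of functions of single hands, which integrate by independence. -/
theorem roundStakes_eq {n : ℕ} (p x : Fin n → ℝ) :
    roundStakes p x = (∑ j, if p j ≤ x j then (1 : ℝ) else 0) - 1
      + 2 * ∏ j, if ¬ p j ≤ x j then (1 : ℝ) else 0 := by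
  rw [Finset.prod_ite_zero, roundStakes, ← card_holders]
  by_cases h : holders p x = ∅
  · have h' := (holders_eq_empty_iff p x).1 h
    simp only [h, Finset.card_empty, if_true]
    rw [if_pos (fun j _ => h' j)]
    norm_num
  · have h' := (holders_eq_empty_iff p x).not.1 h
    rw [if_neg h, if_neg (fun hh => h' fun j => hh j (Finset.mem_univ j))]
    ring

/-- The indicator of the event that player `i` holds and has the best hand of all holders. -/
noncomputable def winIndicator {n : ℕ} (p x : Fin n → ℝ) (i : Fin n) : ℝ :=
  (if p i ≤ x i then 1 else 0) * ∏ j, if p j ≤ x j → x j ≤ x i then 1 else 0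

/-- The stakes factor minus `1` is the virtual ante when somebody holds and `0` otherwise, so the
case split disappears; twice the win indicator minus the hold indicator encodes the gain or loss of
the pot. -/
theorem roundReturn_eq {n : ℕ} (p x : Fin n → ℝ) (i : Fin n) :
    roundReturn p x i = roundStakes p x - 1
      + n * (2 * winIndicator p x i - if p i ≤ x i then 1 else 0) := by
  rw [winIndicator, Finset.prod_ite_zero, roundReturn, roundStakes]
  by_cases h : holders p x = ∅
  · have h' := (holders_eq_empty_iff p x).1 h
    simp [h, h' i]
  · simp only [if_neg h]
    by_cases hi : p i ≤ x i
    · have hm : i ∈ holders p x := by simp [holders, hi]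
      have : (∀ j ∈ holders p x, x j ≤ x i) ↔ ∀ j ∈ Finset.univ, p j ≤ x j → x j ≤ x i := by
        simp [holders]
      simp only [if_pos hm, this, if_pos hi]
      split_ifs <;> simp <;> ring
    · have hm : i ∉ holders p x := by simp [holders, hi]
      simp only [if_neg hm, if_neg hi]
      ring

instance (n : ℕ) : IsProbabilityMeasure (handLaw n) := by
  have : IsProbabilityMeasure ((volume : Measure ℝ).restrict (Set.Icc 0 1)) :=
    ⟨by simp⟩
  unfold handLaw
  infer_instance

theorem measurable_ite_le {Ω : Type*} [MeasurableSpace Ω] {f g : Ω → ℝ} (hf : Measurable f)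
    (hg : Measurable g) : Measurable fun ω => if f ω ≤ g ω then (1 : ℝ) else 0 :=
  Measurable.ite (measurableSet_le hf hg) measurable_const measurable_const

theorem measurable_ite_not_le {Ω : Type*} [MeasurableSpace Ω] {f g : Ω → ℝ} (hf : Measurable f)
    (hg : Measurable g) : Measurable fun ω => if ¬ f ω ≤ g ω then (1 : ℝ) else 0 :=
  Measurable.ite (measurableSet_le hf hg).compl measurable_const measurable_const

theorem measurable_ite_imp {Ω : Type*} [MeasurableSpace Ω] {f g h : Ω → ℝ} (hf : Measurable f)
    (hg : Measurable g) (hh : Measurable h) :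
    Measurable fun ω => if f ω ≤ g ω → g ω ≤ h ω then (1 : ℝ) else 0 := by
  refine Measurable.ite ?_ measurable_const measurable_const
  have : {ω | f ω ≤ g ω → g ω ≤ h ω} = {ω | f ω ≤ g ω}ᶜ ∪ {ω | g ω ≤ h ω} := by
    ext ω
    simp only [Set.mem_ofPred_eq, Set.mem_union, Set.mem_compl_iff]
    tauto
  rw [this]
  exact (measurableSet_le hf hg).compl.union (measurableSet_le hg hh)

theorem measurable_roundStakes {n : ℕ} :
    Measurable fun z : (Fin n → ℝ) × (Fin n → ℝ) => roundStakes z.1 z.2 := by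
  simp only [roundStakes_eq]
  refine Measurable.add (Measurable.sub_const ?_ 1) (Measurable.const_mul ?_ 2)
  · exact Finset.measurable_fun_sum _ fun j _ => measurable_ite_le (by fun_prop) (by fun_prop)
  · exact Finset.measurable_fun_prod _ fun j _ => measurable_ite_not_le (by fun_prop) (by fun_prop)

theorem measurable_winIndicator {n : ℕ} (i : Fin n) :
    Measurable fun z : (Fin n → ℝ) × (Fin n → ℝ) => winIndicator z.1 z.2 i := by
  unfold winIndicator
  refine (measurable_ite_le (by fun_prop) (by fun_prop)).mul ?_
  exact Finset.measurable_fun_prod _ fun j _ =>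
    measurable_ite_imp (by fun_prop) (by fun_prop) (by fun_prop)

theorem measurable_roundReturn {n : ℕ} (i : Fin n) :
    Measurable fun z : (Fin n → ℝ) × (Fin n → ℝ) => roundReturn z.1 z.2 i := by
  simp only [roundReturn_eq]
  refine (measurable_roundStakes.sub_const 1).add (Measurable.const_mul ?_ _)
  exact ((measurable_winIndicator i).const_mul 2).sub
    (measurable_ite_le (by fun_prop) (by fun_prop))

theorem roundStakes_nonneg {n : ℕ} (p x : Fin n → ℝ) : 0 ≤ roundStakes p x := by
  unfold roundStakes
  split_ifs with h
  · exact zero_le_one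
  · have : 1 ≤ (holders p x).card := Finset.card_pos.2 (Finset.nonempty_iff_ne_empty.2 h)
    have : (1 : ℝ) ≤ (holders p x).card := by exact_mod_cast this
    linarith

theorem roundStakes_le {n : ℕ} (p x : Fin n → ℝ) : roundStakes p x ≤ n + 1 := by
  have : (holders p x).card ≤ n := by simpa using Finset.card_le_univ (holders p x)
  have : ((holders p x).card : ℝ) ≤ n := by exact_mod_cast this
  unfold roundStakes
  split_ifs with h
  · linarith [Nat.cast_nonneg (α := ℝ) n]
  · linarith

theorem abs_roundReturn_le {n : ℕ} (p x : Fin n → ℝ) (i : Fin n) :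
    |roundReturn p x i| ≤ 2 * n + 2 := by
  have : (holders p x).card ≤ n := by simpa using Finset.card_le_univ (holders p x)
  have : ((holders p x).card : ℝ) ≤ n := by exact_mod_cast this
  have : (0 : ℝ) ≤ (holders p x).card := Nat.cast_nonneg _
  unfold roundReturn
  rw [abs_le]
  split_ifs <;> constructor <;> linarith

theorem integrable_handLaw_of_bound {n : ℕ} {f : (Fin n → ℝ) → ℝ} (hf : Measurable f) (K : ℝ)
    (h : ∀ x, |f x| ≤ K) : Integrable f (handLaw n) :=
  Integrable.of_bound hf.aestronglyMeasurable K (ae_of_all _ h)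

theorem integrable_roundStakes {n : ℕ} (p : Fin n → ℝ) :
    Integrable (roundStakes p) (handLaw n) :=
  integrable_handLaw_of_bound (measurable_roundStakes.comp measurable_prodMk_left) (n + 1)
    fun x => by rw [abs_of_nonneg (roundStakes_nonneg p x)]; exact roundStakes_le p x

theorem integrable_roundReturn {n : ℕ} (p : Fin n → ℝ) (i : Fin n) :
    Integrable (fun x => roundReturn p x i) (handLaw n) :=
  integrable_handLaw_of_bound ((measurable_roundReturn i).comp measurable_prodMk_left) _
    fun x => abs_roundReturn_le p x i

theorem measurable_alpha {n : ℕ} (i : Fin n) : Measurable fun p : Fin n → ℝ => alpha p i :=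
  ((measurable_roundReturn i).stronglyMeasurable.integral_prod_right').measurable

theorem measurable_beta {n : ℕ} : Measurable fun p : Fin n → ℝ => beta p :=
  (measurable_roundStakes.stronglyMeasurable.integral_prod_right').measurable

theorem beta_nonneg {n : ℕ} (p : Fin n → ℝ) : 0 ≤ beta p :=
  integral_nonneg (roundStakes_nonneg p)

theorem beta_le {n : ℕ} (p : Fin n → ℝ) : beta p ≤ n + 1 := by
  have := integral_mono (integrable_roundStakes p) (integrable_const (n + 1 : ℝ))
    (roundStakes_le p)
  simpa [beta] using this

theorem abs_alpha_le {n : ℕ} (p : Fin n → ℝ) (i : Fin n) : |alpha p i| ≤ 2 * n + 2 := by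
  have := norm_integral_le_of_norm_le_const (μ := handLaw n) (f := fun x => roundReturn p x i)
    (ae_of_all _ fun x => abs_roundReturn_le p x i)
  simpa [alpha] using this

/-- Ties have probability zero. -/
theorem ae_injective_handLaw (n : ℕ) : ∀ᵐ x ∂(handLaw n), Function.Injective x := by
  have key : ∀ i j : Fin n, i ≠ j → ∀ᵐ x ∂(handLaw n), x i ≠ x j := by
    intro i j hij
    have hac : handLaw n ≪ (volume : Measure (Fin n → ℝ)) := by
      unfold handLaw
      rw [← Measure.restrict_pi_pi]
      exact Measure.absolutelyContinuous_of_le Measure.restrict_le_self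
    refine hac.ae_le ?_
    -- A tie between two given players is a proper subspace, hence a null set.
    let E : Submodule ℝ (Fin n → ℝ) :=
      LinearMap.ker (LinearMap.proj (R := ℝ) (φ := fun _ : Fin n => ℝ) i
        - LinearMap.proj (R := ℝ) (φ := fun _ : Fin n => ℝ) j)
    have hE : E ≠ ⊤ := by
      intro h
      have : (Pi.single i 1 : Fin n → ℝ) ∈ E := h ▸ Submodule.mem_top
      simp [E, hij.symm] at this
    have h0 := Measure.addHaar_submodule (volume : Measure (Fin n → ℝ)) E hE
    change ∀ᵐ x ∂(volume : Measure (Fin n → ℝ)), x i ≠ x j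
    rw [ae_iff]
    convert h0 using 2
    ext x
    simp [E, sub_eq_zero]
  have : ∀ᵐ x ∂(handLaw n), ∀ i j : Fin n, i ≠ j → x i ≠ x j := by
    rw [ae_all_iff]; intro i
    rw [ae_all_iff]; intro j
    by_cases hij : i = j
    · simp [hij]
    · simpa [hij] using key i j hij
  filter_upwards [this] with x hx i j hij
  by_contra h
  exact hx i j h hij

/-- Without ties exactly one of the `r` holders wins, and `n (r - 2) + n - n (r - 1) = 0`. -/
theorem sum_roundReturn {n : ℕ} (p : Fin n → ℝ) {x : Fin n → ℝ} (hx : Function.Injective x) :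
    ∑ i, roundReturn p x i = 0 := by
  by_cases h : holders p x = ∅
  · simp [roundReturn, h]
  obtain ⟨b, hb, hmax⟩ := Finset.exists_max_image (holders p x) x
    (Finset.nonempty_iff_ne_empty.2 h)
  have hwin : ∀ i, (if i ∈ holders p x then
      if ∀ j ∈ holders p x, x j ≤ x i then (n : ℝ) else -(n : ℝ) else 0)
      = (if i = b then 2 * (n : ℝ) else 0) - if i ∈ holders p x then (n : ℝ) else 0 := by
    intro i
    by_cases hi : i ∈ holders p x
    · by_cases hib : i = b
      · subst hib
        simp only [hi, if_true, if_pos hmax]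
        ring
      · have : ¬ ∀ j ∈ holders p x, x j ≤ x i := fun hh =>
          hib (hx (le_antisymm (hmax i hi) (hh b hb)))
        simp [hi, hib, if_neg this]
    · have hib : i ≠ b := fun e => hi (e ▸ hb)
      simp [hi, hib]
  simp only [roundReturn, if_neg h, hwin, Finset.sum_add_distrib, Finset.sum_sub_distrib]
  simp
  ring

theorem sum_alpha {n : ℕ} (p : Fin n → ℝ) : ∑ i, alpha p i = 0 := by
  unfold alpha
  rw [← integral_finsetSum _ fun i _ => integrable_roundReturn p i]
  refine integral_eq_zero_of_ae ?_
  filter_upwards [ae_injective_handLaw n] with x hx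
  exact sum_roundReturn p hx

theorem integral_Icc_ite_le {a : ℝ} (ha : a ∈ Set.Icc (0 : ℝ) 1) (f : ℝ → ℝ) :
    ∫ y in Set.Icc (0 : ℝ) 1, (if a ≤ y then f y else 0) = ∫ y in a..1, f y := by
  have : (fun y => if a ≤ y then f y else 0) = Set.indicator (Set.Ici a) f := by
    ext y; simp [Set.indicator]
  rw [this, setIntegral_indicator measurableSet_Ici, intervalIntegral.integral_of_le ha.2,
    ← integral_Icc_eq_integral_Ioc]
  congr 2
  ext y
  simp only [Set.mem_inter_iff, Set.mem_Icc, Set.mem_Ici]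
  constructor
  · rintro ⟨⟨_, h⟩, h'⟩; exact ⟨h', h⟩
  · rintro ⟨h, h'⟩; exact ⟨⟨ha.1.trans h, h'⟩, h⟩

theorem integral_Icc_ite_le_one {a : ℝ} (ha : a ∈ Set.Icc (0 : ℝ) 1) :
    ∫ y in Set.Icc (0 : ℝ) 1, (if a ≤ y then (1 : ℝ) else 0) = 1 - a := by
  rw [integral_Icc_ite_le ha]; simp

theorem integral_Icc_ite_not_le {a : ℝ} (ha : a ∈ Set.Icc (0 : ℝ) 1) :
    ∫ y in Set.Icc (0 : ℝ) 1, (if ¬ a ≤ y then (1 : ℝ) else 0) = a := by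
  have : (fun y => if ¬ a ≤ y then (1 : ℝ) else 0) = fun y => 1 - if a ≤ y then (1 : ℝ) else 0 := by
    ext y; split_ifs <;> norm_num
  rw [this, integral_sub (by simp), integral_Icc_ite_le_one ha]
  · simp
  · refine Integrable.of_bound
      (measurable_ite_le measurable_const measurable_id).aestronglyMeasurable 1 (ae_of_all _ ?_)
    intro y; dsimp; split_ifs <;> simp

/-- Off the null set `y = max a b`, the implication says `y < max a b`. -/
theorem integral_Icc_ite_imp {a b : ℝ} (ha : a ∈ Set.Icc (0 : ℝ) 1) (hb : b ∈ Set.Icc (0 : ℝ) 1) :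
    ∫ y in Set.Icc (0 : ℝ) 1, (if a ≤ y → y ≤ b then (1 : ℝ) else 0) = max a b := by
  have hab : max a b ∈ Set.Icc (0 : ℝ) 1 := ⟨ha.1.trans (le_max_left _ _), max_le ha.2 hb.2⟩
  rw [← integral_Icc_ite_not_le hab]
  refine integral_congr_ae ?_
  have : ∀ᵐ y ∂(volume.restrict (Set.Icc (0 : ℝ) 1)), y ≠ max a b :=
    (measure_eq_zero_iff_ae_notMem.1 (by simp : (volume.restrict (Set.Icc (0 : ℝ) 1)) {max a b} = 0))
  filter_upwards [this] with y hy
  have h1 : (a ≤ y → y ≤ b) ↔ ¬ max a b ≤ y := by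
    rw [max_le_iff]
    constructor
    · rintro h ⟨h1, h2⟩
      exact hy (by rw [le_antisymm (h h1) h2, max_eq_right]; exact h1.trans (h h1))
    · intro h h1
      by_contra h2
      exact h ⟨h1, (not_le.1 h2).le⟩
  simp only [h1]

theorem beta_eq {n : ℕ} {p : Fin n → ℝ} (hp : ∀ j, p j ∈ Set.Icc (0 : ℝ) 1) :
    beta p = ∑ j, (1 - p j) - 1 + 2 * ∏ j, p j := by
  have : IsProbabilityMeasure ((volume : Measure ℝ).restrict (Set.Icc 0 1)) := ⟨by simp⟩
  have hle : ∀ j, Measurable fun x : Fin n → ℝ => if p j ≤ x j then (1 : ℝ) else 0 := fun j =>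
    measurable_ite_le measurable_const (measurable_pi_apply j)
  have hnle : ∀ j, Measurable fun x : Fin n → ℝ => if ¬ p j ≤ x j then (1 : ℝ) else 0 := fun j =>
    measurable_ite_not_le measurable_const (measurable_pi_apply j)
  have hi1 : ∀ j, Integrable (fun x : Fin n → ℝ => if p j ≤ x j then (1 : ℝ) else 0)
      (handLaw n) := fun j => integrable_handLaw_of_bound (hle j) 1 fun x => by
        split_ifs <;> simp
  have hi2 : Integrable (fun x : Fin n → ℝ => ∏ j, if ¬ p j ≤ x j then (1 : ℝ) else 0)
      (handLaw n) := integrable_handLaw_of_bound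
        (Finset.measurable_fun_prod _ fun j _ => hnle j) 1 fun x => by
          rw [Finset.prod_ite_zero]; split_ifs <;> simp
  unfold beta
  simp only [roundStakes_eq]
  have hi3 : Integrable (fun x : Fin n → ℝ => ∑ j, if p j ≤ x j then (1 : ℝ) else 0) (handLaw n) :=
    integrable_finsetSum _ fun j _ => hi1 j
  have hi4 : Integrable (fun x : Fin n → ℝ => (∑ j, if p j ≤ x j then (1 : ℝ) else 0) - 1)
      (handLaw n) := hi3.sub (integrable_const 1)
  rw [integral_add hi4 (hi2.const_mul 2), integral_sub hi3 (integrable_const 1),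
    integral_finsetSum _ fun j _ => hi1 j, integral_const_mul]
  have e1 : ∀ j, ∫ x, (if p j ≤ x j then (1 : ℝ) else 0) ∂(handLaw n) = 1 - p j := fun j => by
    unfold handLaw
    rw [integral_comp_eval (μ := fun _ : Fin n => (volume : Measure ℝ).restrict (Set.Icc 0 1))
      (i := j) (f := fun y => if p j ≤ y then (1 : ℝ) else 0)
      (measurable_ite_le measurable_const measurable_id).aestronglyMeasurable]
    exact integral_Icc_ite_le_one (hp j)
  have e2 : ∫ x, (∏ j, if ¬ p j ≤ x j then (1 : ℝ) else 0) ∂(handLaw n) = ∏ j, p j := by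
    unfold handLaw
    rw [integral_fintype_prod_eq_prod (fun j y => if ¬ p j ≤ y then (1 : ℝ) else 0)]
    exact Finset.prod_congr rfl fun j _ => integral_Icc_ite_not_le (hp j)
  rw [e2, Finset.sum_congr rfl fun j _ => e1 j]
  simp

/-- Condition on the hand `y` of player `i`. An opponent with threshold `a` does not beat it if he
drops or holds at most `y`, which has probability `max a y`. -/
theorem integral_winIndicator {m : ℕ} {p : Fin (m + 1) → ℝ} (hp : ∀ j, p j ∈ Set.Icc (0 : ℝ) 1)
    (i : Fin (m + 1)) :
    ∫ x, winIndicator p x i ∂(handLaw (m + 1))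
      = ∫ y in p i..1, ∏ j, max (p (i.succAbove j)) y := by
  have : IsProbabilityMeasure ((volume : Measure ℝ).restrict (Set.Icc 0 1)) := ⟨by simp⟩
  have hmp := measurePreserving_piFinSuccAbove
    (fun _ : Fin (m + 1) => (volume : Measure ℝ).restrict (Set.Icc 0 1)) i
  let g : ℝ × (Fin m → ℝ) → ℝ := fun z => (if p i ≤ z.1 then 1 else 0) *
    ∏ j, if p (i.succAbove j) ≤ z.2 j → z.2 j ≤ z.1 then 1 else 0
  have hg : Measurable g :=
    (measurable_ite_le measurable_const measurable_fst).mul (Finset.measurable_fun_prod _ fun j _ =>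
      measurable_ite_imp measurable_const (by fun_prop) (by fun_prop))
  have hgb : ∀ z, |g z| ≤ 1 := fun z => by
    simp only [g, Finset.prod_ite_zero]
    split_ifs <;> simp
  have e : ∀ x, winIndicator p x i
      = g (MeasurableEquiv.piFinSuccAbove (fun _ : Fin (m + 1) => ℝ) i x) := fun x => by
    simp only [winIndicator, g, Fin.prod_univ_succAbove _ i]
    simp [-ite_mul, MeasurableEquiv.piFinSuccAbove, Fin.insertNthEquiv, Fin.removeNth]
    rfl
  simp only [e]
  unfold handLaw
  rw [hmp.integral_comp' g, integral_prod _ (Integrable.of_bound hg.aestronglyMeasurable 1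
    (ae_of_all _ hgb)), ← integral_Icc_ite_le (hp i)]
  refine setIntegral_congr_fun measurableSet_Icc fun y hy => ?_
  change ∫ z : Fin m → ℝ, (if p i ≤ y then 1 else 0) *
    ∏ j, (if p (i.succAbove j) ≤ z j → z j ≤ y then (1 : ℝ) else 0) ∂_ = _
  rw [integral_const_mul, integral_fintype_prod_eq_prod
    (fun j v => if p (i.succAbove j) ≤ v → v ≤ y then (1 : ℝ) else 0),
    Finset.prod_congr rfl fun j _ => integral_Icc_ite_imp (hp (i.succAbove j)) hy]
  split_ifs <;> simp

theorem alpha_eq {m : ℕ} {p : Fin (m + 1) → ℝ} (hp : ∀ j, p j ∈ Set.Icc (0 : ℝ) 1)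
    (i : Fin (m + 1)) :
    alpha p i = beta p - 1
      + (m + 1) * (2 * (∫ y in p i..1, ∏ j, max (p (i.succAbove j)) y) - (1 - p i)) := by
  have : IsProbabilityMeasure ((volume : Measure ℝ).restrict (Set.Icc 0 1)) := ⟨by simp⟩
  have hw : Integrable (fun x => winIndicator p x i) (handLaw (m + 1)) :=
    integrable_handLaw_of_bound ((measurable_winIndicator i).comp measurable_prodMk_left) 1
      fun x => by
        simp only [winIndicator, Finset.prod_ite_zero]
        split_ifs <;> simp
  have hh : Integrable (fun x : Fin (m + 1) → ℝ => if p i ≤ x i then (1 : ℝ) else 0)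
      (handLaw (m + 1)) := integrable_handLaw_of_bound
        (measurable_ite_le measurable_const (measurable_pi_apply i)) 1 fun x => by
          split_ifs <;> simp
  have e1 : ∫ x, (if p i ≤ x i then (1 : ℝ) else 0) ∂(handLaw (m + 1)) = 1 - p i := by
    unfold handLaw
    rw [integral_comp_eval (μ := fun _ : Fin (m + 1) => (volume : Measure ℝ).restrict (Set.Icc 0 1))
      (i := i) (f := fun y => if p i ≤ y then (1 : ℝ) else 0)
      (measurable_ite_le measurable_const measurable_id).aestronglyMeasurable]
    exact integral_Icc_ite_le_one (hp i)
  unfold alpha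
  simp only [roundReturn_eq]
  have hs : Integrable (fun x => roundStakes p x - 1) (handLaw (m + 1)) :=
    (integrable_roundStakes p).sub (integrable_const 1)
  have hd : Integrable (fun x => 2 * winIndicator p x i - if p i ≤ x i then 1 else 0)
      (handLaw (m + 1)) := (hw.const_mul 2).sub hh
  rw [integral_add hs (hd.const_mul _),
    integral_sub (integrable_roundStakes p) (integrable_const 1), integral_const_mul,
    integral_sub (hw.const_mul 2) hh, integral_const_mul, e1, integral_winIndicator hp]
  simp [beta]

end Guts

/-! ### The equilibrium threshold, and one player against equal thresholds -/

namespace Guts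

theorem threshold_pow {m : ℕ} (hm : m ≠ 0) : threshold m ^ m = 1 / 2 := by
  rw [threshold, one_div (m : ℝ)]
  exact Real.rpow_inv_natCast_pow (by norm_num) hm

theorem threshold_pos (m : ℕ) : 0 < threshold m := Real.rpow_pos_of_pos (by norm_num) _

theorem threshold_lt_one {m : ℕ} (hm : m ≠ 0) : threshold m < 1 :=
  Real.rpow_lt_one (by norm_num) (by norm_num)
    (one_div_pos.2 (Nat.cast_pos.2 (Nat.pos_of_ne_zero hm)))

theorem half_le_threshold {m : ℕ} (hm : m ≠ 0) : 1 / 2 ≤ threshold m := by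
  rw [← threshold_pow hm]
  exact pow_le_of_le_one (threshold_pos m).le (threshold_lt_one hm).le hm

/-- The expected stakes factor at the symmetric equilibrium is smaller than `1`. -/
theorem mul_one_sub_threshold_lt_one {m : ℕ} (hm : m ≠ 0) : m * (1 - threshold m) < 1 := by
  by_contra! h
  have hm0 : (0 : ℝ) < m := Nat.cast_pos.2 (Nat.pos_of_ne_zero hm)
  -- Otherwise `threshold m ≤ 1 - 1/m ≤ exp (-1/m)`, and the `m`-th power gives `1/2 ≤ 1/e`.
  have h1 : threshold m ≤ Real.exp (-(1 / m)) := by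
    have := Real.add_one_le_exp (-(1 / (m : ℝ)))
    have h2 : 1 / (m : ℝ) ≤ 1 - threshold m := by
      rw [div_le_iff₀ hm0]; linarith
    linarith
  have h2 := pow_le_pow_left₀ (threshold_pos m).le h1 m
  rw [threshold_pow hm, ← Real.exp_nat_mul] at h2
  have h3 : (m : ℝ) * -(1 / m) = -1 := by field_simp
  rw [h3] at h2
  linarith [Real.exp_neg_one_lt_half]

section OneAgainstEqual

variable {m : ℕ} {p : Fin (m + 1) → ℝ} {i : Fin (m + 1)} {x P : ℝ}

theorem mem_Icc_of_succAbove (hx : x ∈ Set.Icc (0 : ℝ) 1) (hP : P ∈ Set.Icc (0 : ℝ) 1)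
    (hi : p i = x) (hj : ∀ j, p (i.succAbove j) = P) (j : Fin (m + 1)) :
    p j ∈ Set.Icc (0 : ℝ) 1 := by
  rcases Fin.eq_self_or_eq_succAbove i j with rfl | ⟨k, rfl⟩
  · rwa [hi]
  · rwa [hj]

/-- The coefficient of `x` vanishes at the equilibrium threshold: there a single deviator cannot
influence the stakes. -/
theorem beta_one_against_equal (hx : x ∈ Set.Icc (0 : ℝ) 1) (hP : P ∈ Set.Icc (0 : ℝ) 1)
    (hi : p i = x) (hj : ∀ j, p (i.succAbove j) = P) :
    beta p = m * (1 - P) - x * (1 - 2 * P ^ m) := by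
  rw [beta_eq (mem_Icc_of_succAbove hx hP hi hj), Fin.sum_univ_succAbove _ i,
    Fin.prod_univ_succAbove _ i, hi]
  simp only [hj, Finset.sum_const, Finset.prod_const, Finset.card_univ, Fintype.card_fin,
    nsmul_eq_mul]
  ring

theorem alpha_one_against_equal (hx : x ∈ Set.Icc (0 : ℝ) 1) (hP : P ∈ Set.Icc (0 : ℝ) 1)
    (hi : p i = x) (hj : ∀ j, p (i.succAbove j) = P) :
    alpha p i = m * (1 - P) - x * (1 - 2 * P ^ m) - 1
      + (m + 1) * (2 * (∫ y in x..1, max P y ^ m) - (1 - x)) := by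
  rw [alpha_eq (mem_Icc_of_succAbove hx hP hi hj), beta_one_against_equal hx hP hi hj, hi]
  simp only [hj, Finset.prod_const, Finset.card_univ, Fintype.card_fin]

theorem integral_max_pow {a P : ℝ} (ha : P ≤ a) (ha' : a ≤ 1) :
    ∫ y in a..1, max P y ^ m = (1 - a ^ (m + 1)) / (m + 1) := by
  have : ∫ y in a..1, max P y ^ m = ∫ y in a..1, y ^ m := by
    refine intervalIntegral.integral_congr fun y hy => ?_
    rw [Set.uIcc_of_le ha'] at hy
    simp only [max_eq_right (ha.trans hy.1)]
  rw [this, integral_pow, one_pow]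

theorem alpha_of_le_threshold (hx : x ∈ Set.Icc (0 : ℝ) 1) (hP : P ∈ Set.Icc (0 : ℝ) 1)
    (hi : p i = x) (hj : ∀ j, p (i.succAbove j) = P) (hPx : P ≤ x) :
    alpha p i = m * (x - P) - 2 * x * (x ^ m - P ^ m) := by
  rw [alpha_one_against_equal hx hP hi hj, integral_max_pow hPx hx.2]
  have : (m + 1 : ℝ) ≠ 0 := by positivity
  field_simp
  ring

theorem alpha_of_threshold_le (hx : x ∈ Set.Icc (0 : ℝ) 1) (hP : P ∈ Set.Icc (0 : ℝ) 1)
    (hi : p i = x) (hj : ∀ j, p (i.succAbove j) = P) (hxP : x ≤ P) :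
    alpha p i = -(m * (1 - 2 * P ^ m) * (P - x)) := by
  have hc : Continuous fun y : ℝ => max P y ^ m := by fun_prop
  have h1 : ∫ y in x..P, max P y ^ m = (P - x) * P ^ m := by
    have : ∫ y in x..P, max P y ^ m = ∫ _ in x..P, P ^ m := by
      refine intervalIntegral.integral_congr fun y hy => ?_
      rw [Set.uIcc_of_le hxP] at hy
      simp only [max_eq_left hy.2]
    rw [this]; simp
  rw [alpha_one_against_equal hx hP hi hj,
    ← intervalIntegral.integral_add_adjacent_intervals (b := P) (hc.intervalIntegrable _ _)
      (hc.intervalIntegrable _ _), h1, integral_max_pow le_rfl hP.2]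
  have : (m + 1 : ℝ) ≠ 0 := by positivity
  field_simp
  ring

end OneAgainstEqual

/-- A convex power lies above its tangent at `P`; in the induction the error is `(k + 1) P^k (x -
P)²`. -/
theorem pow_add_mul_le_pow {P x : ℝ} (hP : 0 ≤ P) (hPx : P ≤ x) (k : ℕ) :
    P ^ (k + 1) + (k + 1) * P ^ k * (x - P) ≤ x ^ (k + 1) := by
  induction k with
  | zero => simp
  | succ k ih =>
    have h1 := mul_le_mul_of_nonneg_right ih (hP.trans hPx)
    have h2 : 0 ≤ (k + 1) * P ^ k * (x - P) ^ 2 := by positivity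
    push_cast
    rw [pow_succ x (k + 1)]
    refine le_trans ?_ h1
    have : (P ^ (k + 1) + (k + 1) * P ^ k * (x - P)) * x - (P ^ (k + 1 + 1) +
      (k + 1 + 1) * P ^ (k + 1) * (x - P)) = (k + 1) * P ^ k * (x - P) ^ 2 := by ring
    linarith

/-! ### Bloc play slightly below the equilibrium threshold -/

section Perturbation

variable {m : ℕ} {ε : ℝ}

theorem le_one_sub_two_mul_pow (hm : m ≠ 0) (hε : 0 ≤ ε) (h : ε ≤ threshold m) :
    ε ≤ 1 - 2 * (threshold m - ε) ^ m := by
  obtain ⟨k, rfl⟩ := Nat.exists_eq_succ_of_ne_zero hm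
  have hp := threshold_pow hm
  set q := threshold (k + 1) with hq
  have hq0 : 0 < q := threshold_pos _
  have hq1 : q < 1 := threshold_lt_one hm
  rw [Nat.succ_eq_add_one, pow_succ] at hp
  have h1 : (q - ε) ^ k ≤ q ^ k := pow_le_pow_left₀ (by linarith) (by linarith) k
  have h2 : 1 / 2 ≤ q ^ k := by
    rw [← hp]; exact mul_le_of_le_one_right (by positivity) hq1.le
  have h3 := mul_le_mul_of_nonneg_right h1 (sub_nonneg.2 h)
  rw [Nat.succ_eq_add_one, pow_succ]
  nlinarith

/-- Bernoulli's inequality for `(1 - ε / q) ^ m`, with `1 / q ≤ 2`. -/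
theorem one_sub_two_mul_pow_le (hm : m ≠ 0) (hε : 0 ≤ ε) (h : ε ≤ threshold m) :
    1 - 2 * (threshold m - ε) ^ m ≤ 2 * m * ε := by
  have hp := threshold_pow hm
  have hq := half_le_threshold hm
  have hq0 := threshold_pos m
  set q := threshold m
  have h1 : ε / q ≤ 1 := by rw [div_le_one hq0]; exact h
  have h2 := one_add_mul_le_pow (a := -(ε / q)) (by linarith) m
  have h3 : q - ε = q * (1 + -(ε / q)) := by field_simp; ring
  have h4 : ε / q ≤ 2 * ε := by
    rw [div_le_iff₀ hq0]; nlinarith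
  have h5 : (m : ℝ) * (ε / q) ≤ m * (2 * ε) := by gcongr
  rw [h3, mul_pow, hp]
  linarith

variable {p : Fin (m + 1) → ℝ} {i : Fin (m + 1)} {x : ℝ}

theorem alpha_le_quadratic (hm : m ≠ 0) (hε : 0 ≤ ε) (h : ε ≤ threshold m) (h' : m * ε ≤ 1 / 4)
    (hx : x ∈ Set.Icc (0 : ℝ) 1) (hi : p i = x)
    (hj : ∀ j, p (i.succAbove j) = threshold m - ε) (hPx : threshold m - ε ≤ x) :
    alpha p i ≤ 2 * m ^ 2 * ε * (x - (threshold m - ε)) - m / 2 * (x - (threshold m - ε)) ^ 2 := by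
  have hb := one_sub_two_mul_pow_le hm hε h
  have hq1 := threshold_lt_one hm
  set P := threshold m - ε with hPdef
  have hP0 : 0 ≤ P := by linarith
  have hP1 : P ≤ 1 := by linarith
  rw [alpha_of_le_threshold hx ⟨hP0, hP1⟩ hi hj hPx]
  obtain ⟨k, rfl⟩ := Nat.exists_eq_succ_of_ne_zero hm
  rw [Nat.succ_eq_add_one] at *
  push_cast at *
  have hB := pow_add_mul_le_pow hP0 hPx k
  -- The condition `m * ε ≤ 1 / 4` gives `1 - 2 P^(k+1) ≤ 1/2`, so already `P^(k+1) ≥ 1/4`.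
  have hk : 1 / 4 ≤ P ^ k := by
    have : P ^ (k + 1) ≤ P ^ k := pow_le_pow_of_le_one hP0 hP1 (Nat.le_succ k)
    linarith
  obtain ⟨u, rfl⟩ : ∃ u, x = P + u := ⟨x - P, by ring⟩
  have hu : 0 ≤ u := by linarith
  rw [add_sub_cancel_left] at *
  have h1 : (P + u) * ((k + 1) * P ^ k * u) ≤ (P + u) * ((P + u) ^ (k + 1) - P ^ (k + 1)) :=
    mul_le_mul_of_nonneg_left (by linarith) (by linarith)
  have hk0 : (0 : ℝ) ≤ k + 1 := by positivity
  have h2 : (k + 1) * u * (1 - 2 * P ^ (k + 1)) ≤ (k + 1) * u * (2 * (k + 1) * ε) :=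
    mul_le_mul_of_nonneg_left hb (by positivity)
  have h3 : (k + 1) * u ^ 2 * (1 / 4) ≤ (k + 1) * u ^ 2 * P ^ k :=
    mul_le_mul_of_nonneg_left hk (by positivity)
  rw [pow_succ P k] at h1 h2
  rw [pow_succ P k]
  linarith

theorem alpha_le_of_perturbation (hm : m ≠ 0) (hε : 0 ≤ ε) (h : ε ≤ threshold m)
    (h' : m * ε ≤ 1 / 4) (hx : x ∈ Set.Icc (0 : ℝ) 1) (hi : p i = x)
    (hj : ∀ j, p (i.succAbove j) = threshold m - ε) : alpha p i ≤ 2 * m ^ 3 * ε ^ 2 := by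
  have hq1 := threshold_lt_one hm
  rcases le_total (threshold m - ε) x with hPx | hPx
  · have := alpha_le_quadratic hm hε h h' hx hi hj hPx
    -- Completing the square: the quadratic bound is maximal at `u = 2mε`, with value `2m³ε²`.
    have h2 : 0 ≤ (m : ℝ) * (x - (threshold m - ε) - 2 * m * ε) ^ 2 := by positivity
    nlinarith
  · rw [alpha_of_threshold_le hx ⟨by linarith, by linarith⟩ hi hj hPx]
    have := hε.trans (le_one_sub_two_mul_pow hm hε h)
    have h1 : 0 ≤ m * (1 - 2 * (threshold m - ε) ^ m) * (threshold m - ε - x) :=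
      mul_nonneg (mul_nonneg (Nat.cast_nonneg m) this) (by linarith)
    have h2 : 0 ≤ 2 * (m : ℝ) ^ 3 * ε ^ 2 := by positivity
    linarith

/-- Above `threshold m`, the quadratic term dominates once `u ≥ η ≥ 8mε`. Below it, the return is
linear in the distance with slope at least `mε`. The bound of order `ε` serves both sides. -/
theorem alpha_le_of_far {η : ℝ} (hm : m ≠ 0) (hε : 0 ≤ ε) (h : ε ≤ threshold m)
    (h' : m * ε ≤ 1 / 4) (hη : 8 * m * ε ≤ η) (hx : x ∈ Set.Icc (0 : ℝ) 1) (hi : p i = x)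
    (hj : ∀ j, p (i.succAbove j) = threshold m - ε) (hfar : η ≤ |x - threshold m|) :
    alpha p i ≤ -(m * η / 4 * ε) := by
  have hq1 := threshold_lt_one hm
  have hm1 : (1 : ℝ) ≤ m := by exact_mod_cast Nat.one_le_iff_ne_zero.2 hm
  have hεη : 8 * ε ≤ η := by nlinarith
  rcases le_abs.1 hfar with hf | hf
  · refine (alpha_le_quadratic hm hε h h' hx hi hj (by linarith)).trans ?_
    obtain ⟨u, hu⟩ : ∃ u, x - (threshold m - ε) = u := ⟨_, rfl⟩
    rw [hu]
    have hηu : η ≤ u := by linarith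
    have hη0 : 0 ≤ η := by linarith
    have h1 : 2 * (m : ℝ) ^ 2 * ε * u - m / 2 * u ^ 2 = m / 2 * u * (4 * m * ε - u) := by ring
    have h2 : m / 2 * u * (4 * m * ε - u) ≤ m / 2 * u * (-(ε / 2)) :=
      mul_le_mul_of_nonneg_left (by nlinarith) (mul_nonneg (by positivity) (by linarith))
    have h3 : m * ε * η ≤ m * ε * u := mul_le_mul_of_nonneg_left hηu (by positivity)
    linarith
  · rw [alpha_of_threshold_le hx ⟨by linarith, by linarith⟩ hi hj (by linarith)]
    have hb := le_one_sub_two_mul_pow hm hε h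
    have h1 : ε * (η / 2) ≤ (1 - 2 * (threshold m - ε) ^ m) * (threshold m - ε - x) :=
      mul_le_mul hb (by linarith) (by linarith) (by linarith)
    have h2 := mul_le_mul_of_nonneg_left h1 (Nat.cast_nonneg (α := ℝ) m)
    have h3 : 0 ≤ m * (ε * η) := by
      have : 0 ≤ η := by linarith
      positivity
    linarith

theorem beta_le_of_perturbation (hm : m ≠ 0) (hε : 0 ≤ ε) (h : ε ≤ threshold m)
    (hx : x ∈ Set.Icc (0 : ℝ) 1) (hi : p i = x)
    (hj : ∀ j, p (i.succAbove j) = threshold m - ε) :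
    beta p ≤ m * (1 - threshold m) + m * ε := by
  have hq1 := threshold_lt_one hm
  rw [beta_one_against_equal hx ⟨by linarith, by linarith⟩ hi hj]
  have := mul_nonneg hx.1 (hε.trans (le_one_sub_two_mul_pow hm hε h))
  linarith

end Perturbation

/-! ### The non-bloc strategy -/

/-- The return of player 1 against a player who always holds and `k` players with threshold `Q`,
if the threshold `x` of player 1 is at most `Q`. -/
noncomputable def nonblocReturn (k : ℕ) (Q x : ℝ) : ℝ :=
  k * (1 - Q) - x - (k + 2) * (1 - x) + (k + 2) * Q ^ k * (Q ^ 2 - x ^ 2) + 2 - 2 * Q ^ (k + 2)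

theorem nonblocB_zero (k : ℕ) (δ : ℝ) : nonblocB (k + 1) δ 0 = 0 := by simp [nonblocB]

theorem nonblocB_succ (k : ℕ) (δ : ℝ) (j : Fin k) :
    nonblocB (k + 1) δ j.succ = threshold (k + 1) + δ := by simp [nonblocB]

theorem alpha_nonblocB {k : ℕ} {δ x : ℝ} (hQ : threshold (k + 1) + δ ∈ Set.Icc (0 : ℝ) 1)
    (hx : 0 ≤ x) (hxQ : x ≤ threshold (k + 1) + δ) :
    alpha (Fin.cons x (nonblocB (k + 1) δ) : Fin (k + 2) → ℝ) 0
      = nonblocReturn k (threshold (k + 1) + δ) x := by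
  set Q := threshold (k + 1) + δ with hQdef
  set p : Fin (k + 2) → ℝ := Fin.cons x (nonblocB (k + 1) δ) with hp
  have hmem : ∀ j, p j ∈ Set.Icc (0 : ℝ) 1 := by
    intro j
    refine Fin.cases ?_ (fun j => ?_) j
    · exact ⟨hx, hxQ.trans hQ.2⟩
    · rw [hp, Fin.cons_succ]
      refine Fin.cases ?_ (fun j => ?_) j
      · rw [nonblocB_zero]; simp
      · rw [nonblocB_succ]; exact hQ
  have hb : beta p = k * (1 - Q) + 1 - x := by
    rw [beta_eq hmem, Fin.sum_univ_succ, Fin.sum_univ_succ, Fin.prod_univ_succ,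
      Fin.prod_univ_succ]
    simp only [hp, Fin.cons_zero, Fin.cons_succ, nonblocB_zero, nonblocB_succ, ← hQdef]
    simp
    ring
  have hprod : ∀ y, ∏ j, max (p (Fin.succAbove 0 j)) y = max 0 y * max Q y ^ k := by
    intro y
    simp only [Fin.succAbove_zero]
    rw [Fin.prod_univ_succ]
    simp only [hp, Fin.cons_succ, nonblocB_zero, nonblocB_succ, ← hQdef]
    simp
  have hc : Continuous fun y : ℝ => max 0 y * max Q y ^ k := by fun_prop
  have h1 : ∫ y in x..Q, max 0 y * max Q y ^ k = (Q ^ 2 - x ^ 2) / 2 * Q ^ k := by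
    have : ∫ y in x..Q, max 0 y * max Q y ^ k = ∫ y in x..Q, y * Q ^ k := by
      refine intervalIntegral.integral_congr fun y hy => ?_
      rw [Set.uIcc_of_le hxQ] at hy
      simp only [max_eq_left hy.2, max_eq_right (hx.trans hy.1)]
    rw [this, intervalIntegral.integral_mul_const, integral_id]
  have h2 : ∫ y in Q..1, max 0 y * max Q y ^ k = (1 - Q ^ (k + 2)) / (k + 2) := by
    have : ∫ y in Q..1, max 0 y * max Q y ^ k = ∫ y in Q..1, y ^ (k + 1) := by
      refine intervalIntegral.integral_congr fun y hy => ?_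
      rw [Set.uIcc_of_le hQ.2] at hy
      simp only [max_eq_right hy.1, max_eq_right (hQ.1.trans hy.1)]
      ring
    rw [this, integral_pow, one_pow]
    push_cast
    ring
  rw [alpha_eq hmem, hb]
  simp only [hprod]
  rw [show p 0 = x from rfl, ← intervalIntegral.integral_add_adjacent_intervals (b := Q)
    (hc.intervalIntegrable _ _) (hc.intervalIntegrable _ _), h1, h2, nonblocReturn]
  have : (k + 2 : ℝ) ≠ 0 := by positivity
  push_cast
  field_simp
  ring

/-- On the diagonal `Q = x = q` the factor `Q² - x²` vanishes, and the derivatives of the two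
remaining powers of `Q` cancel; only `k (1 - Q)` contributes. -/
theorem hasDerivAt_nonblocReturn (k : ℕ) (q : ℝ) :
    HasDerivAt (fun Q => nonblocReturn k Q q) (-k) q := by
  have h0 : HasDerivAt (fun Q : ℝ => Q) 1 q := hasDerivAt_id q
  have := (((((((hasDerivAt_const q (1 : ℝ)).sub h0).const_mul (k : ℝ)).sub_const q).sub_const
    ((k + 2) * (1 - q))).add (((h0.pow k).const_mul (k + 2 : ℝ)).mul
      ((h0.pow 2).sub_const (q ^ 2)))).add_const 2).sub ((h0.pow (k + 2)).const_mul 2)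
  refine this.congr_deriv ?_
  simp only [Pi.pow_apply]
  push_cast
  ring

theorem nonblocReturn_threshold (k : ℕ) :
    nonblocReturn k (threshold (k + 1)) (threshold (k + 1)) = 0 := by
  have := threshold_pow (Nat.succ_ne_zero k)
  rw [Nat.succ_eq_add_one] at this
  rw [nonblocReturn, pow_succ _ (k + 1), this]
  ring

theorem exists_nonblocReturn_neg {k : ℕ} (hk : k ≠ 0) :
    ∃ δ : ℝ, 0 < δ ∧ threshold (k + 1) + δ ≤ 1 ∧
      nonblocReturn k (threshold (k + 1) + δ) (threshold (k + 1)) < 0 := by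
  have hq := threshold_lt_one (Nat.succ_ne_zero k)
  have h0 := nonblocReturn_threshold k
  rw [Nat.succ_eq_add_one] at hq
  set q := threshold (k + 1)
  have hk0 : (-k : ℝ) < 0 := by
    have : (0 : ℝ) < k := Nat.cast_pos.2 (Nat.pos_of_ne_zero hk)
    linarith
  have hs := (hasDerivAt_iff_tendsto_slope.1 (hasDerivAt_nonblocReturn k q)).eventually_lt_const hk0
  -- Only `Q > q` is wanted, so that `δ = Q - q` is positive.
  have hs' := hs.filter_mono (nhdsWithin_mono q (s := Set.Ioi q) fun y hy => ne_of_gt hy)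
  obtain ⟨Q, hQ1, hQ2⟩ := (hs'.and (Ioo_mem_nhdsGT hq)).exists
  refine ⟨Q - q, sub_pos.2 hQ2.1, by linarith [hQ2.2], ?_⟩
  rw [add_sub_cancel]
  rw [slope_def_field, div_neg_iff] at hQ1
  rcases hQ1 with hQ1 | hQ1
  · linarith [hQ2.1, hQ1.2]
  · linarith [hQ1.1]

/-- Against the non-bloc strategy, thresholds near the equilibrium have a return bounded away
from `0`. -/
theorem exists_nonblocB {m : ℕ} (hm : 2 ≤ m) :
    ∃ δ : ℝ, 0 < δ ∧ threshold m + δ ≤ 1 ∧ ∃ η : ℝ, 0 < η ∧ ∃ c : ℝ, 0 < c ∧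
      ∀ x ∈ Set.Icc (0 : ℝ) 1, |x - threshold m| < η →
        alpha (Fin.cons x (nonblocB m δ) : Fin (m + 1) → ℝ) 0 ≤ -c := by
  obtain ⟨k, rfl⟩ : ∃ k, m = k + 1 := ⟨m - 1, by omega⟩
  obtain ⟨δ, hδ, hδ1, hneg⟩ := exists_nonblocReturn_neg (k := k) (by omega)
  have hq := threshold_pos (k + 1)
  set q := threshold (k + 1) with hqdef
  refine ⟨δ, hδ, hδ1, ?_⟩
  have hcont : Continuous fun x => nonblocReturn k (q + δ) x := by
    unfold nonblocReturn; fun_prop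
  set g := nonblocReturn k (q + δ) q with hg
  have h1 : ∀ᶠ x in nhds q, nonblocReturn k (q + δ) x < g / 2 :=
    hcont.continuousAt.eventually_lt_const (by change g < g / 2; linarith)
  obtain ⟨η, hη, hball⟩ := Metric.eventually_nhds_iff.1 h1
  -- Continuity in `x` supplies `η`; the cap `δ` keeps `x ≤ q + δ`, where the closed formula is
  -- valid.
  refine ⟨min η δ, lt_min hη hδ, -(g / 2), by linarith, fun x hx hxq => ?_⟩
  have hxδ : x ≤ q + δ := by
    have := (abs_lt.1 (hxq.trans_le (min_le_right _ _))).2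
    linarith
  rw [alpha_nonblocB ⟨by linarith, hδ1⟩ hx.1 hxδ, neg_neg]
  exact (hball (by rw [Real.dist_eq]; exact hxq.trans_le (min_le_left _ _))).le

end Guts

/-! ### Mixed strategies -/

namespace Guts

section Mixing

variable {m : ℕ}

theorem measurable_cons :
    Measurable fun z : ℝ × (Fin m → ℝ) => (Fin.cons z.1 z.2 : Fin (m + 1) → ℝ) := by
  refine measurable_pi_lambda _ fun j => ?_
  refine Fin.cases ?_ (fun j => ?_) j
  · simpa using measurable_fst
  · simp only [Fin.cons_succ]; fun_prop

theorem isProbabilityMeasure_mix {w : ℝ} (hw0 : 0 ≤ w) (hw1 : w ≤ 1) (a b : Fin m → ℝ) :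
    IsProbabilityMeasure (mix w a b) := by
  constructor
  simp only [mix, Measure.add_apply, Measure.smul_apply, measure_univ, smul_eq_mul, mul_one]
  rw [← ENNReal.ofReal_add (sub_nonneg.2 hw1) hw0]
  simp

theorem isProbabilityMeasure_versus {μ : Measure ℝ} {ν : Measure (Fin m → ℝ)}
    [IsProbabilityMeasure μ] [IsProbabilityMeasure ν] : IsProbabilityMeasure (versus μ ν) :=
  Measure.isProbabilityMeasure_map measurable_cons.aemeasurable

theorem integral_mix {w : ℝ} (hw0 : 0 ≤ w) (hw1 : w ≤ 1) (a b : Fin m → ℝ)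
    (f : (Fin m → ℝ) → ℝ) : ∫ y, f y ∂(mix w a b) = (1 - w) * f a + w * f b := by
  have hi : ∀ y, Integrable f (Measure.dirac y) := fun y =>
    integrable_dirac (by simp)
  rw [mix, integral_add_measure ((hi a).smul_measure ENNReal.ofReal_ne_top)
    ((hi b).smul_measure ENNReal.ofReal_ne_top), integral_smul_measure, integral_smul_measure,
    integral_dirac, integral_dirac, ENNReal.toReal_ofReal (sub_nonneg.2 hw1),
    ENNReal.toReal_ofReal hw0, smul_eq_mul, smul_eq_mul]

theorem integral_versus_mix {μ : Measure ℝ} [IsProbabilityMeasure μ] {w : ℝ} (hw0 : 0 ≤ w)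
    (hw1 : w ≤ 1) (a b : Fin m → ℝ) {f : (Fin (m + 1) → ℝ) → ℝ} (hf : Measurable f) {K : ℝ}
    (hK : ∀ p, |f p| ≤ K) :
    ∫ p, f p ∂(versus μ (mix w a b))
      = ∫ x, ((1 - w) * f (Fin.cons x a) + w * f (Fin.cons x b)) ∂μ := by
  have := isProbabilityMeasure_mix hw0 hw1 a b
  rw [versus, integral_map measurable_cons.aemeasurable hf.aestronglyMeasurable, integral_prod]
  · exact integral_congr_ae (ae_of_all _ fun x =>
      integral_mix hw0 hw1 a b fun y => f (Fin.cons x y))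
  · exact Integrable.of_bound (hf.comp measurable_cons).aestronglyMeasurable K
      (ae_of_all _ fun z => hK _)

theorem abs_beta_le {n : ℕ} (p : Fin n → ℝ) : |beta p| ≤ n + 1 := by
  rw [abs_of_nonneg (beta_nonneg p)]; exact beta_le p

/-- Expectations are linear in the mixture of player 1, so bounds against pure thresholds suffice.
-/
theorem integral_versus_mix_le {μ : Measure ℝ} (hμ : IsMixedSingle μ) {w : ℝ} (hw0 : 0 ≤ w)
    (hw1 : w ≤ 1) (a b : Fin m → ℝ) {f : (Fin (m + 1) → ℝ) → ℝ} (hf : Measurable f) {K : ℝ}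
    (hK : ∀ p, |f p| ≤ K) {c : ℝ} (h : ∀ x ∈ Set.Icc (0 : ℝ) 1,
      (1 - w) * f (Fin.cons x a) + w * f (Fin.cons x b) ≤ c) :
    ∫ p, f p ∂(versus μ (mix w a b)) ≤ c := by
  have := hμ.1
  rw [integral_versus_mix hw0 hw1 a b hf hK]
  have hcons : ∀ y : Fin m → ℝ, Measurable fun x : ℝ => f (Fin.cons x y) := fun y =>
    hf.comp (measurable_cons.comp measurable_prodMk_right)
  have hint : Integrable (fun x => (1 - w) * f (Fin.cons x a) + w * f (Fin.cons x b)) μ :=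
    ((Integrable.of_bound (hcons a).aestronglyMeasurable K (ae_of_all _ fun _ => hK _)).const_mul
      _).add ((Integrable.of_bound (hcons b).aestronglyMeasurable K
        (ae_of_all _ fun _ => hK _)).const_mul _)
  have := integral_mono_ae hint (integrable_const c) (by
    filter_upwards [hμ.2] with x hx using h x hx)
  simpa using this

theorem isMixedSingle_dirac {x : ℝ} (hx : x ∈ Set.Icc (0 : ℝ) 1) :
    IsMixedSingle (Measure.dirac x) :=
  ⟨inferInstance, (ae_dirac_iff measurableSet_Icc).2 hx⟩

theorem measurableSet_cube (n : ℕ) :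
    MeasurableSet {p : Fin n → ℝ | ∀ i, p i ∈ Set.Icc (0 : ℝ) 1} := by
  have : {p : Fin n → ℝ | ∀ i, p i ∈ Set.Icc (0 : ℝ) 1}
      = Set.univ.pi fun _ => Set.Icc (0 : ℝ) 1 := by
    ext p; simp only [Set.mem_ofPred_eq, Set.mem_univ_pi]
  rw [this]
  exact MeasurableSet.univ_pi fun _ => measurableSet_Icc

theorem isMixed_dirac {n : ℕ} {p : Fin n → ℝ} (hp : ∀ i, p i ∈ Set.Icc (0 : ℝ) 1) :
    IsMixed (Measure.dirac p) :=
  ⟨inferInstance, (ae_dirac_iff (measurableSet_cube n)).2 hp⟩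

theorem isMixed_mix {w : ℝ} (hw0 : 0 ≤ w) (hw1 : w ≤ 1) {a b : Fin m → ℝ}
    (ha : ∀ i, a i ∈ Set.Icc (0 : ℝ) 1) (hb : ∀ i, b i ∈ Set.Icc (0 : ℝ) 1) :
    IsMixed (mix w a b) := by
  refine ⟨isProbabilityMeasure_mix hw0 hw1 a b, ?_⟩
  rw [mix, ae_add_measure_iff]
  exact ⟨Measure.ae_smul_measure (isMixed_dirac ha).2 _,
    Measure.ae_smul_measure (isMixed_dirac hb).2 _⟩

theorem isMixed_versus {μ : Measure ℝ} {ν : Measure (Fin m → ℝ)} (hμ : IsMixedSingle μ)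
    (hν : IsMixed ν) : IsMixed (versus μ ν) := by
  have := hμ.1
  have := hν.1
  refine ⟨isProbabilityMeasure_versus, ?_⟩
  rw [versus, ae_map_iff measurable_cons.aemeasurable (measurableSet_cube (m + 1))]
  filter_upwards [Measure.quasiMeasurePreserving_fst.ae hμ.2,
    Measure.quasiMeasurePreserving_snd.ae hν.2] with z h1 h2 i
  refine Fin.cases ?_ (fun j => ?_) i
  · simpa using h1
  · simpa using h2 j

theorem ae_versus_dirac_zero {x : ℝ} {ν : Measure (Fin m → ℝ)} [IsProbabilityMeasure ν] :
    ∀ᵐ p ∂(versus (Measure.dirac x) ν), p 0 = x := by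
  rw [versus, ae_map_iff measurable_cons.aemeasurable
    (measurableSet_eq_fun (measurable_pi_apply 0) measurable_const)]
  have : ∀ᵐ y ∂(Measure.dirac x), y = x := (ae_dirac_iff (measurableSet_singleton x)).2 rfl
  filter_upwards [Measure.quasiMeasurePreserving_fst.ae this] with z hz
  simpa using hz

end Mixing

/-! ### The repeated game -/

section Repeated

variable {n : ℕ}

theorem integrable_alpha (P : Measure (Fin n → ℝ)) [IsProbabilityMeasure P] (i : Fin n) :
    Integrable (fun p => alpha p i) P :=
  Integrable.of_bound (measurable_alpha i).aestronglyMeasurable _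
    (ae_of_all _ fun p => abs_alpha_le p i)

theorem sum_mixedAlpha (P : Measure (Fin n → ℝ)) [IsProbabilityMeasure P] :
    ∑ i, mixedAlpha P i = 0 := by
  unfold mixedAlpha
  rw [← integral_finsetSum _ fun i _ => integrable_alpha P i]
  simp [sum_alpha]

theorem mixedBeta_nonneg (P : Measure (Fin n → ℝ)) : 0 ≤ mixedBeta P :=
  integral_nonneg beta_nonneg

theorem stakes_nonneg (P : ℕ → Measure (Fin n → ℝ)) (N : ℕ) : 0 ≤ stakes P N :=
  Finset.prod_nonneg fun k _ => mixedBeta_nonneg (P k)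

theorem stakes_le_pow {P : ℕ → Measure (Fin n → ℝ)} {b : ℝ} (h : ∀ k, mixedBeta (P k) ≤ b)
    (N : ℕ) : stakes P N ≤ b ^ N := by
  have := Finset.prod_le_prod (s := Finset.range N) (fun k _ => mixedBeta_nonneg (P k))
    fun k _ => h k
  simpa [stakes] using this

theorem jointReturn_others {m : ℕ} (t : ℝ) {P : ℕ → Measure (Fin (m + 1) → ℝ)}
    (hP : ∀ k, IsProbabilityMeasure (P k)) (N : ℕ) :
    jointReturn t P N (others m)
      = ∑ k ∈ Finset.range N, stakes P k * -mixedAlpha (P k) 0 - m * t * stakes P N := by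
  have h : ∀ k, ∑ i ∈ others m, mixedAlpha (P k) i = -mixedAlpha (P k) 0 := fun k => by
    have := hP k
    have h0 := Finset.add_sum_erase Finset.univ (mixedAlpha (P k)) (Finset.mem_univ 0)
    rw [sum_mixedAlpha] at h0
    rw [others]
    linarith
  simp only [jointReturn, truncatedReturn, Finset.sum_sub_distrib]
  rw [Finset.sum_comm]
  simp only [← Finset.mul_sum, h]
  simp [others]
  ring

/-- A strategy of the coalition of all players but player 1 that keeps the return of player 1
below a negative constant and the stakes factor below a constant less than `1` is winning. -/
theorem isWinning_of_bounds {m : ℕ} {ν : Measure (Fin m → ℝ)} (hν : IsProbabilityMeasure ν)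
    {κ b : ℝ} (hκ : 0 < κ) (hb : b < 1)
    (hα : ∀ μ, IsMixedSingle μ → mixedAlpha (versus μ ν) 0 ≤ -κ)
    (hβ : ∀ μ, IsMixedSingle μ → mixedBeta (versus μ ν) ≤ b) : IsWinning ν := by
  refine ⟨κ / 2, by linarith, fun t ht => ?_⟩
  have hb0 : 0 ≤ b := (mixedBeta_nonneg _).trans
    (hβ _ (isMixedSingle_dirac (x := 0) (by simp)))
  have hlim : Tendsto (fun N : ℕ => m * t * b ^ N) atTop (nhds 0) := by
    simpa using (tendsto_pow_atTop_nhds_zero_of_lt_one hb0 hb).const_mul (m * t)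
  obtain ⟨N₀, hN₀⟩ := eventually_atTop.1 (hlim.eventually_lt_const (half_pos hκ))
  -- The `+ 1` ensures that round `0` is played: with stakes `1` it alone brings `κ`, and the fees
  -- cost less than `κ / 2`.
  refine ⟨N₀ + 1, fun N hN μ hμ => ?_⟩
  have hP : ∀ k, IsProbabilityMeasure (versus (μ k) ν) := fun k => by
    have := (hμ k).1
    exact isProbabilityMeasure_versus
  rw [jointReturn_others t hP]
  set P := fun k => versus (μ k) ν with hPdef
  have hterm : ∀ k, 0 ≤ stakes P k * -mixedAlpha (P k) 0 := fun k =>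
    mul_nonneg (stakes_nonneg P k) (by linarith [hα (μ k) (hμ k)])
  have h1 : κ ≤ ∑ k ∈ Finset.range N, stakes P k * -mixedAlpha (P k) 0 := by
    refine le_trans ?_ (Finset.single_le_sum (fun k _ => hterm k)
      (Finset.mem_range.2 (by omega : 0 < N)))
    have := hα (μ 0) (hμ 0)
    simp only [stakes, Finset.range_zero, Finset.prod_empty, one_mul, hPdef]
    linarith
  have h2 : m * t * stakes P N ≤ m * t * b ^ N :=
    mul_le_mul_of_nonneg_left (stakes_le_pow (fun k => hβ (μ k) (hμ k)) N) (by positivity)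
  linarith [hN₀ N (by omega)]

end Repeated

/-! ### The symmetric profile -/

section Equilibrium

variable {m : ℕ}

theorem threshold_mem_Icc (hm : m ≠ 0) : threshold m ∈ Set.Icc (0 : ℝ) 1 :=
  ⟨(threshold_pos m).le, (threshold_lt_one hm).le⟩

theorem alpha_le_zero_of_others_threshold (hm : m ≠ 0) {p : Fin (m + 1) → ℝ} {i : Fin (m + 1)}
    (hi : p i ∈ Set.Icc (0 : ℝ) 1) (hj : ∀ j, p (i.succAbove j) = threshold m) :
    alpha p i ≤ 0 := by
  have := alpha_le_of_perturbation (ε := 0) hm le_rfl (threshold_pos m).le (by simp) hi rfl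
    (by simpa using hj)
  simpa using this

theorem beta_of_others_threshold (hm : m ≠ 0) {p : Fin (m + 1) → ℝ} {i : Fin (m + 1)}
    (hi : p i ∈ Set.Icc (0 : ℝ) 1) (hj : ∀ j, p (i.succAbove j) = threshold m) :
    beta p = m * (1 - threshold m) := by
  rw [beta_one_against_equal hi (threshold_mem_Icc hm) rfl hj, threshold_pow hm]
  ring

theorem alpha_threshold (hm : m ≠ 0) (i : Fin (m + 1)) :
    alpha (fun _ : Fin (m + 1) => threshold m) i = 0 := by
  rw [alpha_of_le_threshold (p := fun _ => threshold m) (x := threshold m) (P := threshold m)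
    (threshold_mem_Icc hm) (threshold_mem_Icc hm) rfl (fun _ => rfl) le_rfl]
  ring

theorem mixedAlpha_dirac_threshold (hm : m ≠ 0) (i : Fin (m + 1)) :
    mixedAlpha (Measure.dirac fun _ : Fin (m + 1) => threshold m) i = 0 := by
  rw [mixedAlpha, integral_dirac, alpha_threshold hm]

theorem mixedBeta_dirac_threshold (hm : m ≠ 0) :
    mixedBeta (Measure.dirac fun _ : Fin (m + 1) => threshold m) = m * (1 - threshold m) := by
  rw [mixedBeta, integral_dirac,
    beta_of_others_threshold (i := 0) hm (threshold_mem_Icc hm) fun _ => rfl]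

theorem isNash_threshold (hm : m ≠ 0) (t : ℝ) :
    IsNash t (fun _ : Fin (m + 1) => threshold m) := by
  rintro i ⟨P, hP, c, hc, hev⟩
  have hae : ∀ k, ∀ᵐ p ∂(P k), p i ∈ Set.Icc (0 : ℝ) 1 ∧
      ∀ j, p (i.succAbove j) = threshold m := fun k => by
    filter_upwards [(hP k).1.2, (hP k).2] with p h1 h2
    exact ⟨h1 i, fun j => h2 _ (by simp [Fin.succAbove_ne])⟩
  have hα : ∀ k, mixedAlpha (P k) i ≤ 0 := fun k =>
    integral_nonpos_of_ae (by
      filter_upwards [hae k] with p hp using alpha_le_zero_of_others_threshold hm hp.1 hp.2)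
  have hβ : ∀ k, mixedBeta (P k) = m * (1 - threshold m) := fun k => by
    have := (hP k).1.1
    rw [mixedBeta, integral_congr_ae (g := fun _ => m * (1 - threshold m))]
    · simp
    · filter_upwards [hae k] with p hp using beta_of_others_threshold hm hp.1 hp.2
  obtain ⟨N, hN⟩ := hev.exists
  -- The stakes agree with those at the profile, so the termination fee cancels and only the
  -- nonpositive returns matter.
  have hs : stakes P N = stakes (fun _ => Measure.dirac fun _ : Fin (m + 1) => threshold m) N := by
    simp only [stakes, hβ, mixedBeta_dirac_threshold hm]
  simp only [jointReturn, Finset.sum_singleton, truncatedReturn, mixedAlpha_dirac_threshold hm,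
    hs, mul_zero, Finset.sum_const_zero] at hN
  have : ∑ k ∈ Finset.range N, stakes P k * mixedAlpha (P k) i ≤ 0 :=
    Finset.sum_nonpos fun k _ => mul_nonpos_of_nonneg_of_nonpos (stakes_nonneg P k) (hα k)
  linarith

theorem not_isStrongNash_threshold (hm : m ≠ 0) {ν : Measure (Fin m → ℝ)} (hν : IsMixed ν)
    (hwin : IsWinning ν) {t : ℝ} (ht : 0 ≤ t) :
    ¬ IsStrongNash t (fun _ : Fin (m + 1) => threshold m) := by
  intro h
  obtain ⟨v, hv, hwin⟩ := hwin
  obtain ⟨N₀, hN₀⟩ := hwin t ht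
  have := hν.1
  have hμ := isMixedSingle_dirac (threshold_mem_Icc hm)
  refine h (others m) ⟨fun _ => versus (Measure.dirac (threshold m)) ν,
    fun _ => ⟨isMixed_versus hμ hν, ?_⟩, v, hv, ?_⟩
  · filter_upwards [ae_versus_dirac_zero (x := threshold m) (ν := ν)] with p hp i hi
    have : i = 0 := by simpa [others] using hi
    rw [this, hp]
  · filter_upwards [eventually_ge_atTop N₀] with N hN
    have h1 := hN₀ N hN (fun _ => Measure.dirac (threshold m)) fun _ => hμ
    have h2 : jointReturn t (fun _ => Measure.dirac fun _ : Fin (m + 1) => threshold m) N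
        (others m) ≤ 0 := by
      rw [jointReturn_others t fun _ => inferInstance]
      simp only [mixedAlpha_dirac_threshold hm, neg_zero, mul_zero, Finset.sum_const_zero]
      have := stakes_nonneg (fun _ => Measure.dirac fun _ : Fin (m + 1) => threshold m) N
      have : 0 ≤ m * t * stakes (fun _ => Measure.dirac fun _ : Fin (m + 1) => threshold m) N := by
        positivity
      linarith
    linarith

end Equilibrium

/-! ### Choice of the weights -/

theorem eventually_mul_lt (a : ℝ) {b : ℝ} (hb : 0 < b) :
    ∀ᶠ ε in nhdsWithin (0 : ℝ) (Set.Ioi 0), a * ε < b := by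
  have : Tendsto (fun ε : ℝ => a * ε) (nhds 0) (nhds (a * 0)) :=
    (continuous_const_mul a).tendsto 0
  rw [mul_zero] at this
  exact (this.eventually_lt_const hb).filter_mono nhdsWithin_le_nhds

/-- For suitable weights, mixing the non-bloc strategy into the bloc strategy keeps the return of
player 1 below a negative constant and the stakes factor below a constant less than `1`. -/
theorem exists_mix_bounds {m : ℕ} (hm : 2 ≤ m) :
    ∃ δ : ℝ, 0 < δ ∧ threshold m + δ ≤ 1 ∧ ∃ β₀ : ℝ, β₀ < 1 ∧ ∃ C₁ : ℝ, 0 < C₁ ∧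
      ∀ C : ℝ, C₁ ≤ C → ∃ ε₁ : ℝ, 0 < ε₁ ∧ ∀ ε : ℝ, 0 < ε → ε < ε₁ →
        0 ≤ threshold m - ε ∧ C * ε ^ 2 ≤ 1 ∧
        ∃ κ : ℝ, 0 < κ ∧ ∀ μ, IsMixedSingle μ →
          mixedAlpha (versus μ (mix (C * ε ^ 2) (blocA m ε) (nonblocB m δ))) 0 ≤ -κ ∧
          mixedBeta (versus μ (mix (C * ε ^ 2) (blocA m ε) (nonblocB m δ))) ≤ β₀ := by
  have hm0 : m ≠ 0 := by omega
  have hmpos : (0 : ℝ) < m := Nat.cast_pos.2 (by omega)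
  obtain ⟨δ, hδ, hδ1, η, hη, c, hc, hnear⟩ := exists_nonblocB hm
  have hgap := mul_one_sub_threshold_lt_one hm0
  have hq0 := threshold_pos m
  have hq1 := threshold_lt_one hm0
  obtain ⟨g, hg⟩ : ∃ g, g = (1 - m * (1 - threshold m)) / 4 := ⟨_, rfl⟩
  have hg0 : 0 < g := by rw [hg]; linarith
  -- `β₀` is halfway between `m (1 - threshold m)` and `1`: one `g` absorbs the shift by `ε`, the
  -- other the admixture. With `C₁ = 3m³/c` the admixture gains at least `3m³ε²` near the
  -- equilibrium, against a loss of `2m³ε²`.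
  refine ⟨δ, hδ, hδ1, m * (1 - threshold m) + 2 * g, by linarith, 3 * m ^ 3 / c, by positivity,
    fun C hC => ?_⟩
  have hC0 : 0 < C := lt_of_lt_of_le (by positivity) hC
  have hCc : 3 * m ^ 3 ≤ C * c := by rwa [div_le_iff₀ hc] at hC
  have hev : ∀ᶠ ε in nhdsWithin (0 : ℝ) (Set.Ioi 0), 1 * ε < 1 ∧ 1 * ε < threshold m ∧
      m * ε < 1 / 4 ∧ 8 * m * ε < η ∧ C * ε < 1 / 2 ∧ C * (2 * m + 4) * ε < m * η / 16 ∧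
      m * ε < g ∧ C * (m + 2) * ε < g := by
    filter_upwards [eventually_mul_lt 1 one_pos, eventually_mul_lt 1 hq0,
      eventually_mul_lt m (show (0 : ℝ) < 1 / 4 by norm_num), eventually_mul_lt (8 * m) hη,
      eventually_mul_lt C one_half_pos,
      eventually_mul_lt (C * (2 * m + 4)) (show 0 < m * η / 16 by positivity),
      eventually_mul_lt m hg0, eventually_mul_lt (C * (m + 2)) hg0] with ε h1 h2 h3 h4 h5 h6 h7 h8
    exact ⟨h1, h2, h3, h4, h5, h6, h7, h8⟩
  obtain ⟨ε₁, hε₁, hsub⟩ := mem_nhdsGT_iff_exists_Ioo_subset.1 hev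
  refine ⟨ε₁, hε₁, fun ε hε hεε₁ => ?_⟩
  obtain ⟨h1, h2, h3, h4, h5, h6, h7, h8⟩ := hsub ⟨hε, hεε₁⟩
  rw [one_mul] at h1 h2
  have hw0 : 0 ≤ C * ε ^ 2 := by positivity
  have hwε : C * ε ^ 2 = C * ε * ε := by ring
  have hwle : C * ε ^ 2 ≤ C * ε := by
    rw [hwε]; exact mul_le_of_le_one_right (by positivity) h1.le
  have hw : C * ε ^ 2 ≤ 1 / 2 := by linarith
  obtain ⟨w, hwdef⟩ : ∃ w, w = C * ε ^ 2 := ⟨_, rfl⟩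
  rw [← hwdef] at hw0 hwε hwle hw ⊢
  -- The two margins left near and far from the equilibrium. They depend on `ε`, while `β₀` does
  -- not.
  refine ⟨by linarith, by linarith, min (m ^ 3 * ε ^ 2) (m * η / 16 * ε),
    lt_min (by positivity) (by positivity), fun μ hμ => ⟨?_, ?_⟩⟩
  · refine integral_versus_mix_le hμ hw0 (by linarith) _ _ (measurable_alpha 0)
      (fun p => abs_alpha_le p 0) fun x hx => ?_
    have hA : ∀ j, (Fin.cons x (blocA m ε) : Fin (m + 1) → ℝ) (Fin.succAbove 0 j)
        = threshold m - ε := fun j => by simp [blocA]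
    by_cases hnx : |x - threshold m| < η
    · refine le_trans ?_ (neg_le_neg (min_le_left _ _))
      have a1 := alpha_le_of_perturbation (p := (Fin.cons x (blocA m ε) : Fin (m + 1) → ℝ)) (i := 0) hm0
        hε.le h2.le h3.le hx
        rfl hA
      have a2 := hnear x hx hnx
      have b1 := mul_le_mul_of_nonneg_left a1 (by linarith : 0 ≤ 1 - w)
      have b2 := mul_le_mul_of_nonneg_left a2 hw0
      have b3 : (1 - w) * (2 * m ^ 3 * ε ^ 2) ≤ 2 * m ^ 3 * ε ^ 2 :=
        mul_le_of_le_one_left (by positivity) (by linarith)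
      have b4 : 3 * m ^ 3 * ε ^ 2 ≤ w * c := by
        rw [hwdef]
        have := mul_le_mul_of_nonneg_right hCc (sq_nonneg ε)
        linarith
      linarith
    · refine le_trans ?_ (neg_le_neg (min_le_right _ _))
      have a1 := alpha_le_of_far (p := (Fin.cons x (blocA m ε) : Fin (m + 1) → ℝ)) (i := 0) hm0
        hε.le h2.le h3.le h4.le hx
        rfl hA (not_lt.1 hnx)
      have a2 := (abs_le.1 (abs_alpha_le (Fin.cons x (nonblocB m δ) : Fin (m + 1) → ℝ) 0)).2
      have b1 := mul_le_mul_of_nonneg_left a1 (by linarith : 0 ≤ 1 - w)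
      have b2 := mul_le_mul_of_nonneg_left a2 hw0
      -- At least half of the bloc gain survives, `(mη/8) ε`; the crude bound on the return against
      -- the non-bloc strategy costs at most `(mη/16) ε`.
      have b3 : 1 / 2 * (m * η / 4 * ε) ≤ (1 - w) * (m * η / 4 * ε) :=
        mul_le_mul_of_nonneg_right (by linarith) (by positivity)
      have b4 := mul_le_mul_of_nonneg_right h6.le hε.le
      have b5 : w * (2 * ((m + 1 : ℕ) : ℝ) + 2) = C * (2 * m + 4) * ε * ε := by
        rw [hwdef]; push_cast; ring
      linarith
  · refine integral_versus_mix_le hμ hw0 (by linarith) _ _ measurable_beta abs_beta_le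
      fun x hx => ?_
    have hA : ∀ j, (Fin.cons x (blocA m ε) : Fin (m + 1) → ℝ) (Fin.succAbove 0 j)
        = threshold m - ε := fun j => by simp [blocA]
    have a1 := beta_le_of_perturbation (p := (Fin.cons x (blocA m ε) : Fin (m + 1) → ℝ)) (i := 0) hm0
        hε.le h2.le hx
      rfl hA
    have a2 := beta_le (Fin.cons x (nonblocB m δ) : Fin (m + 1) → ℝ)
    have b1 : (1 - w) * beta (Fin.cons x (blocA m ε) : Fin (m + 1) → ℝ)
        ≤ beta (Fin.cons x (blocA m ε) : Fin (m + 1) → ℝ) :=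
      mul_le_of_le_one_left (beta_nonneg _) (by linarith)
    have b2 : w * beta (Fin.cons x (nonblocB m δ) : Fin (m + 1) → ℝ) ≤ C * ε * (m + 2) := by
      refine mul_le_mul hwle (a2.trans (by push_cast; linarith)) (beta_nonneg _) (by positivity)
    linarith

theorem nonblocB_mem_Icc {m : ℕ} {δ : ℝ} (hδ : 0 ≤ δ) (hδ1 : threshold m + δ ≤ 1) (j : Fin m) :
    nonblocB m δ j ∈ Set.Icc (0 : ℝ) 1 := by
  have := threshold_pos m
  unfold nonblocB
  split_ifs
  · simp
  · exact ⟨by linarith, hδ1⟩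

theorem blocA_mem_Icc {m : ℕ} (hm : m ≠ 0) {ε : ℝ} (hε : 0 ≤ ε) (hε1 : 0 ≤ threshold m - ε)
    (j : Fin m) : blocA m ε j ∈ Set.Icc (0 : ℝ) 1 :=
  ⟨hε1, by have := threshold_lt_one hm; simp only [blocA]; linarith⟩

end Guts

theorem corollary7p16 (m : ℕ) (hm : 4 ≤ m + 1) :
    (∃ δ : ℝ, 0 < δ ∧ Guts.threshold m + δ ≤ 1 ∧ ∃ β₀ : ℝ, β₀ < 1 ∧
      ∃ C₁ : ℝ, 0 < C₁ ∧ ∀ C : ℝ, C₁ ≤ C → ∃ ε₁ : ℝ, 0 < ε₁ ∧ ∀ ε : ℝ, 0 < ε → ε < ε₁ →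
        0 ≤ Guts.threshold m - ε ∧ C * ε ^ 2 ≤ 1 ∧
        (∀ p₁ ∈ Set.Icc (0 : ℝ) 1,
          Guts.mixedAlpha (Guts.versus (MeasureTheory.Measure.dirac p₁)
            (Guts.mix (C * ε ^ 2) (Guts.blocA m ε) (Guts.nonblocB m δ))) 0 < 0 ∧
          Guts.mixedBeta (Guts.versus (MeasureTheory.Measure.dirac p₁)
            (Guts.mix (C * ε ^ 2) (Guts.blocA m ε) (Guts.nonblocB m δ))) ≤ β₀) ∧
        Guts.IsWinning (Guts.mix (C * ε ^ 2) (Guts.blocA m ε) (Guts.nonblocB m δ))) ∧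
    ∀ t : ℝ, 0 ≤ t → Guts.IsNash t (fun _ : Fin (m + 1) => Guts.threshold m) ∧
      ¬ Guts.IsStrongNash t (fun _ : Fin (m + 1) => Guts.threshold m) := by
  have hm0 : m ≠ 0 := by omega
  obtain ⟨δ, hδ, hδ1, β₀, hβ₀, C₁, hC₁, h⟩ := Guts.exists_mix_bounds (m := m) (by omega)
  have hwin : ∀ C ε κ : ℝ, C₁ ≤ C → C * ε ^ 2 ≤ 1 → 0 < κ → (∀ μ, Guts.IsMixedSingle μ →
      Guts.mixedAlpha (Guts.versus μ
        (Guts.mix (C * ε ^ 2) (Guts.blocA m ε) (Guts.nonblocB m δ))) 0 ≤ -κ ∧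
      Guts.mixedBeta (Guts.versus μ
        (Guts.mix (C * ε ^ 2) (Guts.blocA m ε) (Guts.nonblocB m δ))) ≤ β₀) →
      Guts.IsWinning (Guts.mix (C * ε ^ 2) (Guts.blocA m ε) (Guts.nonblocB m δ)) :=
    fun C ε κ hC hw hκ hb => Guts.isWinning_of_bounds
      (Guts.isProbabilityMeasure_mix (mul_nonneg (hC₁.le.trans hC) (sq_nonneg ε)) hw _ _) hκ hβ₀
      (fun μ hμ => (hb μ hμ).1) fun μ hμ => (hb μ hμ).2
  refine ⟨⟨δ, hδ, hδ1, β₀, hβ₀, C₁, hC₁, fun C hC => ?_⟩, fun t ht =>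
    ⟨Guts.isNash_threshold hm0 t, ?_⟩⟩
  · obtain ⟨ε₁, hε₁, h⟩ := h C hC
    refine ⟨ε₁, hε₁, fun ε hε hεε₁ => ?_⟩
    obtain ⟨h0, hw, κ, hκ, hb⟩ := h ε hε hεε₁
    refine ⟨h0, hw, fun p₁ hp₁ => ?_, hwin C ε κ hC hw hκ hb⟩
    have := hb _ (Guts.isMixedSingle_dirac hp₁)
    exact ⟨this.1.trans_lt (neg_lt_zero.2 hκ), this.2⟩
  -- Any admissible weight gives a profitable coalition; `C = C₁` and `ε = ε₁ / 2` will do.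
  · obtain ⟨ε₁, hε₁, h⟩ := h C₁ le_rfl
    obtain ⟨h0, hw, κ, hκ, hb⟩ := h (ε₁ / 2) (half_pos hε₁) (half_lt_self hε₁)
    exact Guts.not_isStrongNash_threshold hm0
      (Guts.isMixed_mix (mul_nonneg hC₁.le (sq_nonneg _)) hw
        (Guts.blocA_mem_Icc hm0 (half_pos hε₁).le h0) (Guts.nonblocB_mem_Icc hδ.le hδ1))
      (hwin C₁ _ κ le_rfl hw hκ hb) ht
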